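/- For $k=0,1,2,\dots$ let $\lambda^{[k]}$ be the function on $\mathbb{C}$ given by $\lambda^{[k]}=|\lambda|^{k}$ for $k$ even and $\lambda^{[k]}=\lambda|\lambda|^{k-1}$ for $k$ odd, and let $\mathcal{P}(r2)$ be their complex linear span. For a Borel probability measure $\mu$ on $\mathbb{C}$ with $\int|\lambda|^n\,d\mu<\infty$ for all $n\ge 0$, put $\langle p,q\rangle=\int_{\mathbb{C}}p\,\overline{q}\,d\mu$ on $\mathcal{P}(r2)$. If the Gram–Schmidt process applied to $\lambda^{[0]},\lambda^{[1]},\lambda^{[2]},\dots$ does not break down (every vector that it produces has positive norm), let $p_0,p_1,p_2,\dots$ be the resulting orthonormal polynomials and put $p_{-1}=0$. The Jacobi parameters of $\mu$ are then $$\alpha_{j+1}=\langle\lambda\overline{p_j},p_j\rangle\in\mathbb{C},\qquad \beta_{j+1}=\langle\lambda\overline{p_j},p_{j+1}\rangle>0\qquad(j=0,1,2,\dots),$$ that is, the coefficients in the recurrence $\beta_{j+1}p_{j+1}(\lambda)=\lambda\overline{p_j(\lambda)}-\alpha_{j+1}p_j(\lambda)-\beta_jp_{j-1}(\lambda)$,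 $\lambda\in\mathbb{C}$. A symmetric biradial measure is a Borel measure on $\mathbb{C}$ of the form $$\mu(E)=\rho_1^+\big(\{r\ge 0: re^{i\phi_1(r)}\in E\}\big)+\rho_2^+\big(\{r\ge 0: re^{i\phi_2(r)}\in E\}\big),$$ where $\rho_1^+,\rho_2^+$ are positive Borel measures on $[0,\infty)$ with $\rho_1^+([0,\infty))+\rho_2^+([0,\infty))=1$, and $\phi_1,\phi_2:[0,\infty)\to\mathbb{R}$ are Borel measurable with $\phi_1(r)\equiv\phi_2(r)+\pi \pmod{2\pi}$ for all $r\ge 0$. **Theorem.** Let $\{\alpha_j\}_{j=1}^\infty$ be a bounded sequence of complex numbers and $\{\beta_j\}_{j=1}^\infty$ a bounded sequence of positive real numbers. Then there exists a compactly supported symmetric biradial measure $\mu$ on $\mathbb{C}$ with finite moments for which the Gram–Schmidt process does not break down and whose Jacobi parameters are $\{\alpha_j\}_{j=1}^\infty$, $\{\beta_j\}_{j=1}^\infty$. -/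

import Mathlib

open MeasureTheory Complex
open scoped NNReal

noncomputable section

/-! ### The monomials of `P(r2)` and the Gram-Schmidt process -/

/-- The monomial `λ^{[k]}` of `P(r2)`: it is `λ |λ| ^ (k - 1)` for odd `k` and `|λ| ^ k` for
even `k`. The space `P(r2)` is the complex linear span of these functions. -/
def r2Monomial (k : ℕ) (z : ℂ) : ℂ :=
  if Odd k then z * (‖z‖ : ℂ) ^ (k - 1) else (‖z‖ : ℂ) ^ k

/-- The (semi-)inner product `⟨p, q⟩ = ∫ p(λ) conj (q(λ)) dρ(λ)`, linear in the first variable. -/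
def r2Inner (ρ : Measure ℂ) (p q : ℂ → ℂ) : ℂ :=
  ∫ z, p z * (starRingEnd ℂ) (q z) ∂ρ

/-- The unnormalized Gram-Schmidt process applied to `λ^{[0]}, λ^{[1]}, λ^{[2]}, …`:
`g_k = λ^{[k]} - ∑_{i < k} (⟨λ^{[k]}, g_i⟩ / ⟨g_i, g_i⟩) g_i`.
It acts on polynomials as functions on `ℂ`, not on their classes modulo `ρ`-null sets. -/
def r2GramSchmidt (ρ : Measure ℂ) (k : ℕ) : ℂ → ℂ :=
  r2Monomial k - ∑ i : Fin k,
    (r2Inner ρ (r2Monomial k) (r2GramSchmidt ρ i) /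
      r2Inner ρ (r2GramSchmidt ρ i) (r2GramSchmidt ρ i)) • r2GramSchmidt ρ i
termination_by k
decreasing_by exact i.2

/-- The squared norm `⟨g_k, g_k⟩ = ∫ |g_k|² dρ` of the `k`-th Gram-Schmidt vector. -/
def r2GramSchmidtNormSq (ρ : Measure ℂ) (k : ℕ) : ℝ :=
  ∫ z, ‖r2GramSchmidt ρ k z‖ ^ 2 ∂ρ

/-- The polynomial `p_k = g_k / ‖g_k‖` produced by the Gram-Schmidt process. -/
def r2OrthoPoly (ρ : Measure ℂ) (k : ℕ) : ℂ → ℂ := fun z =>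
  ((Real.sqrt (r2GramSchmidtNormSq ρ k))⁻¹ : ℝ) * r2GramSchmidt ρ k z

/-- `ρ` is a Borel probability measure all of whose absolute moments `∫ |λ|^n dρ` are finite. -/
def HasFiniteMoments (ρ : Measure ℂ) : Prop :=
  IsProbabilityMeasure ρ ∧ ∀ n : ℕ, Integrable (fun z : ℂ => ‖z‖ ^ n) ρ

/-- The function `λ τ p`, that is, `λ ↦ λ conj (p(λ))`. -/
def lambdaTau (p : ℂ → ℂ) : ℂ → ℂ := fun z => z * (starRingEnd ℂ) (p z)

/-- The Gram-Schmidt process for `ρ` never breaks down, and the resulting (infinite) sequences of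
Jacobi parameters are `α_1, α_2, …` and `β_1, β_2, …`. The sequences are indexed from `0` here:
`α j` stands for `α_{j+1}` and `β j` for `β_{j+1}`. -/
structure HasJacobiParameters (ρ : Measure ℂ) (α : ℕ → ℂ) (β : ℕ → ℝ) : Prop where
  finiteMoments : HasFiniteMoments ρ
  /-- no breakdown: every vector produced by the process has positive norm -/
  no_breakdown : ∀ k, 0 < r2GramSchmidtNormSq ρ k
  /-- `α_{j+1} = ⟨λ conj p_j, p_j⟩` -/
  alpha_eq : ∀ j, α j = r2Inner ρ (lambdaTau (r2OrthoPoly ρ j)) (r2OrthoPoly ρ j)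
  /-- `β_{j+1} = ⟨λ conj p_j, p_{j+1}⟩` -/
  beta_eq : ∀ j, (β j : ℂ) = r2Inner ρ (lambdaTau (r2OrthoPoly ρ j)) (r2OrthoPoly ρ (j + 1))
  /-- `β_1 p_1 = λ conj p_0 - α_1 p_0`, the recurrence for `j = 0` (where `p_{-1} = 0`) -/
  recurrence_zero : ∀ z, (β 0 : ℂ) * r2OrthoPoly ρ 1 z =
    lambdaTau (r2OrthoPoly ρ 0) z - α 0 * r2OrthoPoly ρ 0 z
  /-- `β_{j+2} p_{j+2} = λ conj p_{j+1} - α_{j+2} p_{j+1} - β_{j+1} p_j` -/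
  recurrence_succ : ∀ j z, (β (j + 1) : ℂ) * r2OrthoPoly ρ (j + 2) z =
    lambdaTau (r2OrthoPoly ρ (j + 1)) z - α (j + 1) * r2OrthoPoly ρ (j + 1) z
      - (β j : ℂ) * r2OrthoPoly ρ j z

/-! ### Biradial measures -/

/-- The transformation `R_φ(z) = e^{-i φ(|z|)} z` of the plane. -/
def rotateBack (φ : ℝ≥0 → ℝ) (z : ℂ) : ℂ := exp (-(I * (φ ‖z‖₊ : ℂ))) * z

/-- The parametrization `r ↦ r e^{i φ(r)}` of the curve that `R_φ` maps to the half-line. -/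
def biradialCurve (φ : ℝ≥0 → ℝ) (r : ℝ≥0) : ℂ := ((r : ℝ) : ℂ) * exp (I * (φ r : ℂ))

/-- The measure `E ↦ ν (R_φ(E) ∩ [0, ∞))` on `ℂ`, as the image of `ν` under
`r ↦ r e^{i φ(r)}`; see `curveMeasure_apply` for the equality. -/
def curveMeasure (ν : Measure ℝ≥0) (φ : ℝ≥0 → ℝ) : Measure ℂ := ν.map (biradialCurve φ)

theorem measurable_biradialCurve {φ : ℝ≥0 → ℝ} (hφ : Measurable φ) :
    Measurable (biradialCurve φ) := by
  unfold biradialCurve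
  fun_prop

theorem curveMeasure_apply (ν : Measure ℝ≥0) {φ : ℝ≥0 → ℝ} (hφ : Measurable φ)
    {E : Set ℂ} (hE : MeasurableSet E) :
    curveMeasure ν φ E = ν {r : ℝ≥0 | ((r : ℝ) : ℂ) ∈ rotateBack φ '' E} := by
  rw [curveMeasure, Measure.map_apply (measurable_biradialCurve hφ) hE]
  congr 1
  ext r
  simp only [Set.mem_preimage, Set.mem_ofPred_eq, Set.mem_image, biradialCurve, rotateBack]
  constructor
  · intro h
    refine ⟨_, h, ?_⟩
    have hn : ‖((r : ℝ) : ℂ) * exp (I * (φ r : ℂ))‖₊ = r := by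
      ext
      rw [coe_nnnorm, norm_mul, mul_comm I, norm_exp_ofReal_mul_I]
      simp
    rw [hn, mul_left_comm, ← exp_add]
    simp
  · rintro ⟨z, hz, h⟩
    have hn : ‖z‖₊ = r := by
      have := congrArg (fun w : ℂ => ‖w‖) h
      ext
      rw [coe_nnnorm]
      simp only [norm_mul] at this
      rw [← mul_neg, ← ofReal_neg, mul_comm I, norm_exp_ofReal_mul_I] at this
      simpa using this
    rw [hn] at h
    rw [← h, mul_right_comm, ← exp_add]
    simpa using hz

/-- `ρ = ρ_1 + ρ_2` is the biradial measure built from the measures `ν₁, ν₂` on `[0, ∞)` of total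
mass `1` and the measurable angle functions `φ₁, φ₂`. -/
structure IsBiradialRep (ρ : Measure ℂ) (ν₁ ν₂ : Measure ℝ≥0) (φ₁ φ₂ : ℝ≥0 → ℝ) : Prop where
  total_mass : ν₁ Set.univ + ν₂ Set.univ = 1
  measurable₁ : Measurable φ₁
  measurable₂ : Measurable φ₂
  eq_add : ρ = curveMeasure ν₁ φ₁ + curveMeasure ν₂ φ₂

/-- A symmetric biradial measure: moreover `φ₁ = φ₂ + π` modulo `2π`. -/
def IsSymmetricBiradial (ρ : Measure ℂ) : Prop :=
  ∃ ν₁ ν₂ φ₁ φ₂, IsBiradialRep ρ ν₁ ν₂ φ₁ φ₂ ∧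
    ∀ r, ∃ k : ℤ, φ₁ r = φ₂ r + Real.pi + 2 * Real.pi * k

end

/-!
The recurrence defines functions `p_j` on `ℂ` pointwise. If they are orthonormal in `L²(μ)`, then
`λ^{[k]} - β_1 ⋯ β_k p_k` is a combination of `p_0, …, p_{k-1}`, so the Gram-Schmidt vectors of `μ`
are `β_1 ⋯ β_k p_k` and the Jacobi parameters of `μ` are the given ones
(`IsJacobiOrthonormal.hasJacobiParameters`). It remains to find a symmetric biradial measure on a
disc for which the `p_j` are orthonormal.

Truncate the Jacobi matrix `J` to size `N`. Since `J` is complex symmetric, the antilinear operator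
`f ↦ J conj f` is self-adjoint for the real inner product of `ℂ^N`, so it has a real orthonormal
eigenbasis. If `x` is the conjugate of an eigenvector with eigenvalue `t`, then the eigenvalue
equation is the recurrence at the point `l = t (conj x_0) / x_0`, whence `x_k = p_k(l) x_0`. Parseval's
identity for the `2N` eigenvectors says that `p_0, …, p_{N-1}` are orthonormal for the measure with
masses `|x_0|² / 2` at the points `l` (`exists_truncated_measure`). The eigenvalues are bounded
independently of `N`, hence so are the points, and a weak limit point of these measures makes all
the `p_j` orthonormal (`exists_limit_measure`).

Finally, `p_i conj p_j` is a sum of functions `u(|λ|)`, `v(|λ|) λ` and conjugates of the latter, so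
the orthonormality relations see a measure only through the distribution of `|λ|` and the
conditional mean `r w(r)` of `λ` on the circle `|λ| = r`. Since `|w| ≤ 1`, the same data come
from a measure with two antipodal points on each circle, of conditional masses `(1 ± |w|) / 2`,
which is symmetric biradial (`exists_isSymmetricBiradial_integral_eq`).
-/

/-! ### The polynomials of the recurrence -/

/-- The `k`-th entry of the product of the Jacobi matrix with diagonal `α` and off-diagonal `β`
with the column `x`. -/
def jacobiRow (α : ℕ → ℂ) (β : ℕ → ℝ) (x : ℕ → ℂ) : ℕ → ℂ
  | 0 => α 0 * x 0 + β 0 * x 1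
  | k + 1 => α (k + 1) * x (k + 1) + β (k + 1) * x (k + 2) + β k * x k

/-- The functions on `ℂ` defined pointwise by the three-term recurrence
`β_{j+1} p_{j+1} = λ conj p_j - α_{j+1} p_j - β_j p_{j-1}` and `p_0 = 1`. -/
noncomputable def jacobiPoly (α : ℕ → ℂ) (β : ℕ → ℝ) : ℕ → ℂ → ℂ
  | 0 => fun _ => 1
  | 1 => fun z => (z - α 0) / β 0
  | j + 2 => fun z => (z * (starRingEnd ℂ) (jacobiPoly α β (j + 1) z)
      - α (j + 1) * jacobiPoly α β (j + 1) z - β j * jacobiPoly α β j z) / β (j + 1)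

section Recurrence

variable {α : ℕ → ℂ} {β : ℕ → ℝ}

theorem lambdaTau_jacobiPoly (hβ : ∀ j, 0 < β j) (k : ℕ) (z : ℂ) :
    lambdaTau (jacobiPoly α β k) z = jacobiRow α β (fun i => jacobiPoly α β i z) k := by
  have hβ' : ∀ j, (β j : ℂ) ≠ 0 := fun j => ofReal_ne_zero.2 (hβ j).ne'
  cases k with
  | zero =>
    simp only [lambdaTau, jacobiRow, jacobiPoly, map_one, mul_one]
    rw [mul_div_cancel₀ _ (hβ' 0)]
    ring
  | succ k =>
    simp only [lambdaTau, jacobiRow, jacobiPoly]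
    rw [mul_div_cancel₀ _ (hβ' (k + 1))]
    ring

/-- A column `x` that solves the recurrence at the point `l` is the multiple `x 0` of the column
of the values of the polynomials at `l`. -/
theorem eq_jacobiPoly_mul_of_recurrence (hβ : ∀ j, 0 < β j) {x : ℕ → ℂ} {l : ℂ} {t : ℝ} {N : ℕ}
    (hl : l * x 0 = t * (starRingEnd ℂ) (x 0))
    (hx : ∀ k < N, t * (starRingEnd ℂ) (x k) = jacobiRow α β x k) :
    ∀ k ≤ N, x k = jacobiPoly α β k l * x 0 := by
  have hβ' : ∀ j, (β j : ℂ) ≠ 0 := fun j => ofReal_ne_zero.2 (hβ j).ne'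
  intro k
  induction k using Nat.strong_induction_on with
  | _ k ih =>
    intro hk
    match k with
    | 0 => simp [jacobiPoly]
    | 1 =>
      have h := hx 0 (by omega)
      simp only [jacobiRow] at h
      simp only [jacobiPoly]
      rw [div_mul_eq_mul_div, eq_div_iff (hβ' 0)]
      linear_combination -h - hl
    | j + 2 =>
      have h := hx (j + 1) (by omega)
      have h1 := ih (j + 1) (by omega) (by omega)
      have h0 := ih j (by omega) (by omega)
      simp only [jacobiRow] at h
      simp only [jacobiPoly]
      rw [div_mul_eq_mul_div, eq_div_iff (hβ' (j + 1))]
      have h1' := congrArg (starRingEnd ℂ) h1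
      rw [map_mul] at h1'
      linear_combination t * h1' - h - α (j + 1) * h1 - β j * h0
        - (starRingEnd ℂ) (jacobiPoly α β (j + 1) l) * hl

/-- Every polynomial of the recurrence has the form `a(|λ|) + b(|λ|) λ`. -/
theorem exists_jacobiPoly_eq (α : ℕ → ℂ) (β : ℕ → ℝ) (k : ℕ) :
    ∃ a b : ℝ → ℂ, Continuous a ∧ Continuous b ∧
      ∀ z, jacobiPoly α β k z = a ‖z‖ + b ‖z‖ * z := by
  induction k using Nat.strong_induction_on with
  | _ k ih =>
    match k with
    | 0 => exact ⟨fun _ => 1, fun _ => 0, by fun_prop, by fun_prop, fun z => by simp [jacobiPoly]⟩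
    | 1 =>
      exact ⟨fun _ => -α 0 / β 0, fun _ => 1 / β 0, by fun_prop, by fun_prop,
        fun z => by simp only [jacobiPoly]; ring⟩
    | j + 2 =>
      obtain ⟨a, b, ha, hb, h⟩ := ih (j + 1) (by omega)
      obtain ⟨a', b', ha', hb', h'⟩ := ih j (by omega)
      refine ⟨fun r => ((starRingEnd ℂ) (b r) * (r : ℂ) ^ 2 - α (j + 1) * a r - β j * a' r)
          / β (j + 1), fun r => ((starRingEnd ℂ) (a r) - α (j + 1) * b r - β j * b' r)
          / β (j + 1), ?_, ?_, fun z => ?_⟩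
      · have := continuous_conj.comp hb
        simp only [Function.comp_def] at this
        fun_prop
      · have := continuous_conj.comp ha
        simp only [Function.comp_def] at this
        fun_prop
      · simp only [jacobiPoly, h, h', map_add, map_mul]
        rw [← mul_conj']
        ring

theorem continuous_jacobiPoly (α : ℕ → ℂ) (β : ℕ → ℝ) (k : ℕ) :
    Continuous (jacobiPoly α β k) := by
  obtain ⟨a, b, ha, hb, h⟩ := exists_jacobiPoly_eq α β k
  rw [funext h]
  fun_prop

end Recurrence

/-! ### Gram-Schmidt vectors when the polynomials are orthonormal -/

section GramSchmidt

variable {α : ℕ → ℂ} {β : ℕ → ℝ} {μ : Measure ℂ}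

theorem r2Monomial_succ (k : ℕ) : r2Monomial (k + 1) = lambdaTau (r2Monomial k) := by
  funext z
  rcases Nat.even_or_odd k with hk | hk
  · simp only [lambdaTau, r2Monomial, if_pos hk.add_one, if_neg (Nat.not_odd_iff_even.2 hk)]
    simp
  · obtain ⟨m, rfl⟩ := hk
    have h1 : ¬ Odd (2 * m + 1 + 1) := by simp [parity_simps]
    have h2 : Odd (2 * m + 1) := ⟨m, rfl⟩
    simp only [lambdaTau, r2Monomial, if_neg h1, if_pos h2, map_mul, map_pow, conj_ofReal,
      Nat.add_sub_cancel]
    rw [← mul_assoc, mul_conj']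
    ring

theorem lambdaTau_mem_span (hβ : ∀ j, 0 < β j) {k : ℕ} {f : ℂ → ℂ}
    (hf : f ∈ Submodule.span ℂ (jacobiPoly α β '' Set.Iio k)) :
    lambdaTau f ∈ Submodule.span ℂ (jacobiPoly α β '' Set.Iio (k + 1)) := by
  have hmem : ∀ i < k + 1,
      jacobiPoly α β i ∈ Submodule.span ℂ (jacobiPoly α β '' Set.Iio (k + 1)) :=
    fun i hi => Submodule.subset_span ⟨i, hi, rfl⟩
  induction hf using Submodule.span_induction with
  | mem f hf =>
    obtain ⟨i, hi, rfl⟩ := hf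
    have hi' : i < k := hi
    cases i with
    | zero =>
      have h : lambdaTau (jacobiPoly α β 0) =
          α 0 • jacobiPoly α β 0 + (β 0 : ℂ) • jacobiPoly α β 1 :=
        funext fun z => lambdaTau_jacobiPoly hβ 0 z
      rw [h]
      exact add_mem (Submodule.smul_mem _ _ (hmem _ (by omega)))
        (Submodule.smul_mem _ _ (hmem _ (by omega)))
    | succ i =>
      have h : lambdaTau (jacobiPoly α β (i + 1)) =
          α (i + 1) • jacobiPoly α β (i + 1) + (β (i + 1) : ℂ) • jacobiPoly α β (i + 2)
            + (β i : ℂ) • jacobiPoly α β i :=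
        funext fun z => lambdaTau_jacobiPoly hβ (i + 1) z
      rw [h]
      exact add_mem (add_mem (Submodule.smul_mem _ _ (hmem _ (by omega)))
        (Submodule.smul_mem _ _ (hmem _ (by omega)))) (Submodule.smul_mem _ _ (hmem _ (by omega)))
  | zero =>
    have h : lambdaTau (0 : ℂ → ℂ) = 0 := by funext z; simp [lambdaTau]
    rw [h]
    exact zero_mem _
  | add f g _ _ hf hg =>
    have h : lambdaTau (f + g) = lambdaTau f + lambdaTau g := by
      funext z; simp [lambdaTau, mul_add]
    rw [h]
    exact add_mem hf hg
  | smul c f _ hf =>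
    have h : lambdaTau (c • f) = (starRingEnd ℂ) c • lambdaTau f := by
      funext z; simp only [lambdaTau, Pi.smul_apply, smul_eq_mul, map_mul]; ring
    rw [h]
    exact Submodule.smul_mem _ _ hf

/-- The monomial `λ^{[k]}` is `β_1 ⋯ β_k p_k` plus a combination of `p_0, …, p_{k-1}`. -/
theorem r2Monomial_sub_mem_span (hβ : ∀ j, 0 < β j) (k : ℕ) :
    r2Monomial k - ((∏ i ∈ Finset.range k, β i : ℝ) : ℂ) • jacobiPoly α β k ∈
      Submodule.span ℂ (jacobiPoly α β '' Set.Iio k) := by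
  induction k with
  | zero =>
    have h : r2Monomial 0 - ((∏ i ∈ Finset.range 0, β i : ℝ) : ℂ) • jacobiPoly α β 0 = 0 := by
      funext z; simp [r2Monomial, jacobiPoly]
    rw [h]
    exact zero_mem _
  | succ k ih =>
    have h := lambdaTau_mem_span hβ ih
    have hmem : ∀ i < k + 1,
        jacobiPoly α β i ∈ Submodule.span ℂ (jacobiPoly α β '' Set.Iio (k + 1)) :=
      fun i hi => Submodule.subset_span ⟨i, hi, rfl⟩
    have h2 : lambdaTau (r2Monomial k - ((∏ i ∈ Finset.range k, β i : ℝ) : ℂ) • jacobiPoly α β k)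
        = r2Monomial (k + 1)
          - ((∏ i ∈ Finset.range k, β i : ℝ) : ℂ) • lambdaTau (jacobiPoly α β k) := by
      rw [r2Monomial_succ]
      funext z
      simp only [lambdaTau, Pi.sub_apply, Pi.smul_apply, smul_eq_mul, map_sub, map_mul,
        conj_ofReal]
      ring
    rw [h2] at h
    cases k with
    | zero =>
      have h3 : lambdaTau (jacobiPoly α β 0) =
          α 0 • jacobiPoly α β 0 + (β 0 : ℂ) • jacobiPoly α β 1 :=
        funext fun z => lambdaTau_jacobiPoly hβ 0 z
      convert add_mem h (Submodule.smul_mem _ (α 0) (hmem 0 (by omega))) using 1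
      rw [h3]
      simp
      module
    | succ k =>
      have h3 : lambdaTau (jacobiPoly α β (k + 1)) =
          α (k + 1) • jacobiPoly α β (k + 1) + (β (k + 1) : ℂ) • jacobiPoly α β (k + 2)
            + (β k : ℂ) • jacobiPoly α β k :=
        funext fun z => lambdaTau_jacobiPoly hβ (k + 1) z
      convert add_mem h (Submodule.smul_mem _ ((∏ i ∈ Finset.range (k + 1), β i : ℝ) : ℂ)
        (add_mem (Submodule.smul_mem _ (α (k + 1)) (hmem (k + 1) (by omega)))
          (Submodule.smul_mem _ (β k : ℂ) (hmem k (by omega))))) using 1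
      rw [h3, Finset.prod_range_succ _ (k + 1), ofReal_mul]
      module

/-- The polynomials of the recurrence are orthonormal in `L²(μ)`; the integrability of their
products, without which the integral has a junk value, is part of the notion. -/
structure IsJacobiOrthonormal (μ : Measure ℂ) (α : ℕ → ℂ) (β : ℕ → ℝ) : Prop where
  integrable : ∀ i j,
    Integrable (fun z => jacobiPoly α β i z * (starRingEnd ℂ) (jacobiPoly α β j z)) μ
  inner_eq : ∀ i j, r2Inner μ (jacobiPoly α β i) (jacobiPoly α β j) = if i = j then 1 else 0

theorem IsJacobiOrthonormal.inner_sum (h : IsJacobiOrthonormal μ α β) (s : Finset ℕ) (c : ℕ → ℂ)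
    (i : ℕ) : r2Inner μ (∑ l ∈ s, c l • jacobiPoly α β l) (jacobiPoly α β i) =
      if i ∈ s then c i else 0 := by
  have h1 : r2Inner μ (∑ l ∈ s, c l • jacobiPoly α β l) (jacobiPoly α β i) =
      ∑ l ∈ s, c l * r2Inner μ (jacobiPoly α β l) (jacobiPoly α β i) := by
    simp only [r2Inner, Finset.sum_apply, Pi.smul_apply, smul_eq_mul, Finset.sum_mul, mul_assoc]
    rw [integral_finsetSum _ fun l _ => (h.integrable l i).const_mul (c l)]
    simp only [integral_const_mul]
  rw [h1]
  simp [h.inner_eq]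

theorem IsJacobiOrthonormal.r2GramSchmidt_eq (h : IsJacobiOrthonormal μ α β)
    (hβ : ∀ j, 0 < β j) (k : ℕ) :
    r2GramSchmidt μ k = ((∏ i ∈ Finset.range k, β i : ℝ) : ℂ) • jacobiPoly α β k := by
  induction k using Nat.strong_induction_on with
  | _ k ih =>
    have hb : ∀ i, ((∏ l ∈ Finset.range i, β l : ℝ) : ℂ) ≠ 0 := fun i =>
      ofReal_ne_zero.2 (Finset.prod_pos fun l _ => hβ l).ne'
    have hspan := r2Monomial_sub_mem_span (α := α) hβ k
    rw [← Finset.coe_range, Submodule.mem_span_image_finset_iff_exists_fun] at hspan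
    obtain ⟨c', hc'⟩ := hspan
    obtain ⟨c, hc⟩ : ∃ c : ℕ → ℂ, ∑ l ∈ Finset.range k, c l • jacobiPoly α β l =
        r2Monomial k - ((∏ i ∈ Finset.range k, β i : ℝ) : ℂ) • jacobiPoly α β k := by
      refine ⟨fun l => if hl : l ∈ Finset.range k then c' ⟨l, hl⟩ else 0, ?_⟩
      rw [← hc', ← Finset.sum_coe_sort]
      exact Finset.sum_congr rfl fun i _ => congrArg (· • _) (dif_pos i.2)
    set b : ℂ := ((∏ i ∈ Finset.range k, β i : ℝ) : ℂ) with hbdef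
    have hexp : r2Monomial k =
        ∑ l ∈ Finset.range (k + 1), Function.update c k b l • jacobiPoly α β l := by
      rw [Finset.sum_range_succ, Function.update_self]
      have : ∑ l ∈ Finset.range k, Function.update c k b l • jacobiPoly α β l =
          ∑ l ∈ Finset.range k, c l • jacobiPoly α β l :=
        Finset.sum_congr rfl fun l hl => by
          rw [Function.update_of_ne (Finset.mem_range.1 hl).ne]
      rw [this, hc]
      module
    have hcoef : ∀ i : Fin k, (r2Inner μ (r2Monomial k) (r2GramSchmidt μ i) /
        r2Inner μ (r2GramSchmidt μ i) (r2GramSchmidt μ i)) • r2GramSchmidt μ i =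
        c i • jacobiPoly α β i := by
      intro i
      have h1 : r2Inner μ (r2Monomial k) (jacobiPoly α β i) = c i := by
        rw [hexp, h.inner_sum, if_pos (Finset.mem_range.2 (by omega)),
          Function.update_of_ne i.2.ne]
      have h2 : r2Inner μ (r2Monomial k) (r2GramSchmidt μ i) =
          ((∏ l ∈ Finset.range i, β l : ℝ) : ℂ) * c i := by
        rw [ih i i.2, ← h1]
        simp only [r2Inner, Pi.smul_apply, smul_eq_mul, map_mul, conj_ofReal]
        rw [← integral_const_mul]
        congr 1; funext z; ring
      have h3 : r2Inner μ (r2GramSchmidt μ i) (r2GramSchmidt μ i) =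
          ((∏ l ∈ Finset.range i, β l : ℝ) : ℂ) * ((∏ l ∈ Finset.range i, β l : ℝ) : ℂ) := by
        have h4 := h.inner_eq i i
        rw [if_pos rfl] at h4
        rw [ih i i.2, ← mul_one (((∏ l ∈ Finset.range i, β l : ℝ) : ℂ) * _), ← h4]
        simp only [r2Inner, Pi.smul_apply, smul_eq_mul, map_mul, conj_ofReal]
        rw [← integral_const_mul]
        congr 1; funext z; ring
      rw [h2, h3, ih i i.2, smul_smul]
      congr 1
      have := hb i
      field_simp
    rw [r2GramSchmidt, Finset.sum_congr rfl fun i _ => hcoef i,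
      Fin.sum_univ_eq_sum_range (fun i => c i • jacobiPoly α β i), hc]
    module

theorem IsJacobiOrthonormal.r2GramSchmidtNormSq_eq (h : IsJacobiOrthonormal μ α β)
    (hβ : ∀ j, 0 < β j) (k : ℕ) :
    r2GramSchmidtNormSq μ k = (∏ i ∈ Finset.range k, β i) ^ 2 := by
  have h1 := h.inner_eq k k
  rw [if_pos rfl, r2Inner] at h1
  simp only [mul_conj', ← ofReal_pow, integral_complex_ofReal] at h1
  have h2 : ∫ z, ‖jacobiPoly α β k z‖ ^ 2 ∂μ = 1 := by exact_mod_cast h1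
  rw [r2GramSchmidtNormSq, h.r2GramSchmidt_eq hβ]
  simp only [Pi.smul_apply, smul_eq_mul, norm_mul, mul_pow, norm_real, Real.norm_eq_abs, sq_abs]
  rw [integral_const_mul, h2, mul_one]

theorem IsJacobiOrthonormal.r2OrthoPoly_eq (h : IsJacobiOrthonormal μ α β)
    (hβ : ∀ j, 0 < β j) (k : ℕ) : r2OrthoPoly μ k = jacobiPoly α β k := by
  have hb : 0 < ∏ l ∈ Finset.range k, β l := Finset.prod_pos fun l _ => hβ l
  funext z
  rw [r2OrthoPoly, h.r2GramSchmidtNormSq_eq hβ, Real.sqrt_sq hb.le, h.r2GramSchmidt_eq hβ,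
    Pi.smul_apply, smul_eq_mul, ← mul_assoc, ← ofReal_mul, inv_mul_cancel₀ hb.ne', ofReal_one,
    one_mul]

/-- Orthonormality determines the Jacobi parameters: the Gram-Schmidt process returns the
polynomials of the recurrence. -/
theorem IsJacobiOrthonormal.hasJacobiParameters (h : IsJacobiOrthonormal μ α β)
    (hβ : ∀ j, 0 < β j) (hμ : HasFiniteMoments μ) : HasJacobiParameters μ α β := by
  have hsum : ∀ j, ∃ s : Finset ℕ, ∃ c : ℕ → ℂ, j ∈ s ∧ j + 1 ∈ s ∧ c j = α j ∧
      c (j + 1) = β j ∧ lambdaTau (jacobiPoly α β j) = ∑ l ∈ s, c l • jacobiPoly α β l := by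
    intro j
    cases j with
    | zero =>
      refine ⟨{0, 1}, fun l => if l = 0 then α 0 else β 0, by simp, by simp, by simp, by simp, ?_⟩
      funext z
      rw [lambdaTau_jacobiPoly hβ]
      simp [jacobiRow]
    | succ j =>
      refine ⟨{j, j + 1, j + 2}, fun l => if l = j then β j else if l = j + 1 then α (j + 1)
        else β (j + 1), by simp, by simp, by simp,
        by simp [show j + 1 + 1 ≠ j by omega], ?_⟩
      funext z
      rw [lambdaTau_jacobiPoly hβ, Finset.sum_insert (by simp), Finset.sum_insert (by simp)]
      simp [jacobiRow]
      ring
  refine ⟨hμ, fun k => ?_, fun j => ?_, fun j => ?_, fun z => ?_, fun j z => ?_⟩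
  · rw [h.r2GramSchmidtNormSq_eq hβ]
    exact pow_pos (Finset.prod_pos fun l _ => hβ l) 2
  · obtain ⟨s, c, hj, -, hcj, -, he⟩ := hsum j
    rw [h.r2OrthoPoly_eq hβ, he, h.inner_sum, if_pos hj, hcj]
  · obtain ⟨s, c, -, hj, -, hcj, he⟩ := hsum j
    rw [h.r2OrthoPoly_eq hβ, h.r2OrthoPoly_eq hβ, he, h.inner_sum, if_pos hj, hcj]
  · rw [h.r2OrthoPoly_eq hβ, h.r2OrthoPoly_eq hβ, lambdaTau_jacobiPoly hβ]
    simp only [jacobiRow]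
    ring
  · rw [h.r2OrthoPoly_eq hβ, h.r2OrthoPoly_eq hβ, h.r2OrthoPoly_eq hβ, lambdaTau_jacobiPoly hβ]
    simp only [jacobiRow]
    ring

end GramSchmidt

/-! ### Truncated Jacobi matrices -/

/-- The entries of the complex symmetric tridiagonal Jacobi matrix. -/
noncomputable def jacobiEntry (α : ℕ → ℂ) (β : ℕ → ℝ) (k l : ℕ) : ℂ :=
  (if l = k then α k else 0) + (if l = k + 1 then (β k : ℂ) else 0)
    + (if l + 1 = k then (β l : ℂ) else 0)

section Truncation

variable {α : ℕ → ℂ} {β : ℕ → ℝ}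

theorem jacobiEntry_comm (α : ℕ → ℂ) (β : ℕ → ℝ) (k l : ℕ) :
    jacobiEntry α β k l = jacobiEntry α β l k := by
  unfold jacobiEntry
  rcases lt_trichotomy k l with h | h | h
  · have h1 : l ≠ k := by omega
    have h2 : ¬ l + 1 = k := by omega
    have h3 : ¬ k = l + 1 := by omega
    have h4 : k ≠ l := by omega
    simp [h1, h2, h3, h4, eq_comm]
  · simp [h]
  · have h1 : l ≠ k := by omega
    have h2 : ¬ k + 1 = l := by omega
    have h3 : ¬ l = k + 1 := by omega
    have h4 : k ≠ l := by omega
    simp [h1, h2, h3, h4, eq_comm]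

theorem sum_jacobiEntry_mul {N : ℕ} {x : ℕ → ℂ} (hx : ∀ l, N ≤ l → x l = 0) {k : ℕ}
    (hk : k < N) :
    ∑ l ∈ Finset.range N, jacobiEntry α β k l * x l = jacobiRow α β x k := by
  simp only [jacobiEntry, add_mul, Finset.sum_add_distrib, ite_mul, zero_mul]
  have h2 : (∑ l ∈ Finset.range N, if l = k + 1 then (β k : ℂ) * x l else 0) =
      β k * x (k + 1) := by
    rw [Finset.sum_ite_eq']
    split_ifs with h
    · rfl
    · rw [hx (k + 1) (by simpa using h), mul_zero]
  rw [Finset.sum_ite_eq', if_pos (Finset.mem_range.2 hk), h2]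
  cases k with
  | zero => simp [jacobiRow]
  | succ k =>
    have h3 : (∑ l ∈ Finset.range N, if l + 1 = k + 1 then (β l : ℂ) * x l else 0) =
        β k * x k := by
      simp only [Nat.add_right_cancel_iff]
      rw [Finset.sum_ite_eq', if_pos (Finset.mem_range.2 (by omega))]
    rw [h3]
    rfl

/-- The space `ℂ^N` with its real Euclidean structure. -/
abbrev RealEuclideanComplex (N : ℕ) : Type := PiLp 2 fun _ : Fin N => ℂ

/-- The antilinear operator `f ↦ J conj f` of the truncated Jacobi matrix, as a real linear map. -/
noncomputable def truncatedJacobi (α : ℕ → ℂ) (β : ℕ → ℝ) (N : ℕ) :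
    RealEuclideanComplex N →ₗ[ℝ] RealEuclideanComplex N where
  toFun f := WithLp.toLp 2 fun k => ∑ l : Fin N, jacobiEntry α β k l * (starRingEnd ℂ) (f l)
  map_add' f g := by
    ext k
    simp [mul_add, Finset.sum_add_distrib]
  map_smul' c f := by
    ext k
    simp only [PiLp.smul_apply, real_smul, map_mul, conj_ofReal, RingHom.id_apply,
      Finset.mul_sum]
    exact Finset.sum_congr rfl fun l _ => by ring

/-- Symmetry of the Jacobi matrix makes its antilinear operator self-adjoint over `ℝ`. -/
theorem isSymmetric_truncatedJacobi (α : ℕ → ℂ) (β : ℕ → ℝ) (N : ℕ) :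
    (truncatedJacobi α β N).IsSymmetric := by
  intro f g
  simp only [PiLp.inner_apply, Complex.inner, truncatedJacobi, LinearMap.coe_mk, AddHom.coe_mk,
    map_sum, map_mul, conj_conj, Finset.sum_mul, Finset.mul_sum, ← re_sum]
  rw [Finset.sum_comm, ← conj_re, map_sum]
  simp only [map_sum, map_mul, conj_conj]
  congr 1
  refine Finset.sum_congr rfl fun k _ => Finset.sum_congr rfl fun l _ => ?_
  rw [jacobiEntry_comm α β l k]
  ring

/-- A real orthonormal eigenbasis of the truncation: `x i` lists the conjugates of the coordinates
of the `i`-th vector, followed by zeros, and `t i` is its eigenvalue. The orthogonality relations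
are those between the rows of the basis, obtained from Parseval's identity. -/
theorem exists_truncated_eigenbasis (α : ℕ → ℂ) (β : ℕ → ℝ) (N : ℕ) :
    ∃ (n : ℕ) (t : Fin n → ℝ) (x : Fin n → ℕ → ℂ),
      (∀ i k, N ≤ k → x i k = 0) ∧ (∀ i, ∃ k < N, x i k ≠ 0) ∧
      (∀ i, ∀ k < N, t i * (starRingEnd ℂ) (x i k) = jacobiRow α β (x i) k) ∧
      ∀ a < N, ∀ b < N, ∑ i, x i a * (starRingEnd ℂ) (x i b) = if a = b then 2 else 0 := by
  have hT := isSymmetric_truncatedJacobi α β N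
  set e := hT.eigenvectorBasis rfl with he
  set t := hT.eigenvalues rfl with ht
  obtain ⟨x, hx0, hx⟩ : ∃ x : Fin (Module.finrank ℝ (RealEuclideanComplex N)) → ℕ → ℂ,
      (∀ i k, N ≤ k → x i k = 0) ∧
      ∀ i k (hk : k < N), x i k = (starRingEnd ℂ) (e i ⟨k, hk⟩) :=
    ⟨fun i k => if hk : k < N then (starRingEnd ℂ) (e i ⟨k, hk⟩) else 0,
      fun i k hk => dif_neg hk.not_gt, fun i k hk => dif_pos hk⟩
  refine ⟨_, t, x, hx0, fun i => ?_, fun i k hk => ?_, fun a ha b hb => ?_⟩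
  · by_contra! h
    apply e.orthonormal.ne_zero i
    ext k
    have := h k k.2
    rw [hx i k k.2] at this
    simpa using this
  · have h1 := (hT.hasEigenvector_eigenvectorBasis rfl i).apply_eq_smul
    have h2 := congrArg (fun f : RealEuclideanComplex N => f ⟨k, hk⟩) h1
    rw [← sum_jacobiEntry_mul (hx0 i) hk, hx i k hk, conj_conj, Finset.sum_range]
    simp only [truncatedJacobi, LinearMap.coe_mk, AddHom.coe_mk, PiLp.smul_apply, real_smul] at h2
    simp only [hx i _ (Fin.is_lt _)]
    exact h2.symm
  · simp only [hx _ _ ha, hx _ _ hb]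
    -- the real orthonormal basis of `ℂ^N` made of the vectors `δ_k` and `i δ_k`
    have hr : ∀ (f : RealEuclideanComplex N) (k : Fin N),
        inner ℝ (WithLp.toLp 2 (Pi.single k 1)) f = (f k).re := by
      intro f k
      rw [PiLp.inner_apply, Finset.sum_eq_single k]
      · simp [Complex.inner]
      · intro l _ hl
        simp [hl]
      · simp
    have hi : ∀ (f : RealEuclideanComplex N) (k : Fin N),
        inner ℝ (WithLp.toLp 2 (Pi.single k I)) f = (f k).im := by
      intro f k
      rw [PiLp.inner_apply, Finset.sum_eq_single k]
      · simp [Complex.inner]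
      · intro l _ hl
        simp [hl]
      · simp
    have key : ∀ u v : RealEuclideanComplex N, ∑ i, inner ℝ u (e i) * inner ℝ v (e i) =
        inner ℝ u v := fun u v => by
      rw [← e.sum_inner_mul_inner u v]
      exact Finset.sum_congr rfl fun i _ => by rw [real_inner_comm v]
    have krr := key (WithLp.toLp 2 (Pi.single ⟨a, ha⟩ 1)) (WithLp.toLp 2 (Pi.single ⟨b, hb⟩ 1))
    have kii := key (WithLp.toLp 2 (Pi.single ⟨a, ha⟩ I)) (WithLp.toLp 2 (Pi.single ⟨b, hb⟩ I))
    have kri := key (WithLp.toLp 2 (Pi.single ⟨a, ha⟩ 1)) (WithLp.toLp 2 (Pi.single ⟨b, hb⟩ I))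
    have kir := key (WithLp.toLp 2 (Pi.single ⟨a, ha⟩ I)) (WithLp.toLp 2 (Pi.single ⟨b, hb⟩ 1))
    simp only [hr, hi] at krr kii kri kir
    apply Complex.ext
    · simp only [re_sum, mul_re, conj_re, conj_im, conj_conj]
      have : ∀ i, (e i ⟨a, ha⟩).re * (e i ⟨b, hb⟩).re - -(e i ⟨a, ha⟩).im * (e i ⟨b, hb⟩).im =
        (e i ⟨a, ha⟩).re * (e i ⟨b, hb⟩).re + (e i ⟨a, ha⟩).im * (e i ⟨b, hb⟩).im :=
          fun i => by ring
      simp only [this, Finset.sum_add_distrib]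
      rw [krr, kii]
      by_cases hab : a = b
      · subst hab; norm_num
      · simp [hab]
    · simp only [im_sum, mul_im, conj_re, conj_im, conj_conj]
      have : ∀ i, (e i ⟨a, ha⟩).re * (e i ⟨b, hb⟩).im + -(e i ⟨a, ha⟩).im * (e i ⟨b, hb⟩).re =
        (e i ⟨a, ha⟩).re * (e i ⟨b, hb⟩).im - (e i ⟨a, ha⟩).im * (e i ⟨b, hb⟩).re :=
          fun i => by ring
      simp only [this, Finset.sum_sub_distrib]
      rw [kri, kir]
      by_cases hab : a = b
      · subst hab; simp
      · simp [hab]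

end Truncation

/-! ### Orthonormality on a disc -/

section Disc

variable {α : ℕ → ℂ} {β : ℕ → ℝ}

theorem norm_jacobiRow_le {A B M : ℝ} (hβ : ∀ j, 0 < β j) (hA : ∀ j, ‖α j‖ ≤ A)
    (hB : ∀ j, β j ≤ B) {x : ℕ → ℂ} (hx : ∀ l, ‖x l‖ ≤ M) (k : ℕ) :
    ‖jacobiRow α β x k‖ ≤ (A + 2 * B) * M := by
  have hM : 0 ≤ M := (norm_nonneg _).trans (hx 0)
  have h1 : ∀ j l, ‖α j * x l‖ ≤ A * M := fun j l => by
    rw [norm_mul]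
    exact mul_le_mul (hA j) (hx l) (norm_nonneg _) ((norm_nonneg _).trans (hA j))
  have h2 : ∀ j l, ‖(β j : ℂ) * x l‖ ≤ B * M := fun j l => by
    rw [norm_mul, norm_real, Real.norm_of_nonneg (hβ j).le]
    exact mul_le_mul (hB j) (hx l) (norm_nonneg _) ((hβ j).le.trans (hB j))
  have hBM : 0 ≤ B * M := mul_nonneg ((hβ 0).le.trans (hB 0)) hM
  cases k with
  | zero =>
    refine (norm_add_le _ _).trans ?_
    linarith [h1 0 0, h2 0 1]
  | succ k =>
    refine (norm_add₃_le).trans ?_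
    linarith [h1 (k + 1) (k + 1), h2 (k + 1) (k + 2), h2 k k]

/-- The eigenvalues of all truncations lie in a fixed interval: compare both sides of the
eigenvalue equation at a coordinate of largest modulus. -/
theorem abs_le_of_recurrence {A B : ℝ} (hβ : ∀ j, 0 < β j) (hA : ∀ j, ‖α j‖ ≤ A)
    (hB : ∀ j, β j ≤ B) {x : ℕ → ℂ} {t : ℝ} {N : ℕ} (hx0 : ∀ k, N ≤ k → x k = 0)
    (hne : ∃ k < N, x k ≠ 0)
    (hx : ∀ k < N, t * (starRingEnd ℂ) (x k) = jacobiRow α β x k) : |t| ≤ A + 2 * B := by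
  obtain ⟨m, hm, hmx⟩ := hne
  obtain ⟨k, hk, hmax⟩ := Finset.exists_max_image (Finset.range N) (fun k => ‖x k‖)
    ⟨m, Finset.mem_range.2 hm⟩
  have hle : ∀ l, ‖x l‖ ≤ ‖x k‖ := fun l => by
    rcases lt_or_ge l N with hl | hl
    · exact hmax l (Finset.mem_range.2 hl)
    · rw [hx0 l hl, norm_zero]
      exact norm_nonneg _
  have hpos : 0 < ‖x k‖ := (norm_pos_iff.2 hmx).trans_le (hle m)
  have h := norm_jacobiRow_le hβ hA hB hle k
  rw [← hx k (Finset.mem_range.1 hk), norm_mul, RCLike.norm_conj, norm_real, Real.norm_eq_abs] at h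
  exact le_of_mul_le_mul_right h hpos

/-- The spectral measure of a truncation: an eigenvector with first coordinate conjugate to `x 0`
and eigenvalue `t` contributes the mass `|x 0|² / 2` at the point `t (conj x 0) / x 0`. The factor
`1 / 2` appears because the real dimension of `ℂ^N` is `2 N`. -/
theorem exists_truncated_measure {A B : ℝ} (hβ : ∀ j, 0 < β j) (hA : ∀ j, ‖α j‖ ≤ A)
    (hB : ∀ j, β j ≤ B) {N : ℕ} (hN : 0 < N) :
    ∃ ν : ProbabilityMeasure (Metric.closedBall (0 : ℂ) (A + 2 * B)), ∀ a < N, ∀ b < N,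
      ∫ z : Metric.closedBall (0 : ℂ) (A + 2 * B),
        jacobiPoly α β a z * (starRingEnd ℂ) (jacobiPoly α β b z) ∂(ν : Measure _) =
        if a = b then 1 else 0 := by
  obtain ⟨n, t, x, hx0, hne, hrec, horth⟩ := exists_truncated_eigenbasis α β N
  -- the first coordinate of an eigenvector determines all the others
  have hfirst : ∀ i, x i 0 ≠ 0 := by
    intro i h0
    obtain ⟨k, hk, hkx⟩ := hne i
    apply hkx
    rw [eq_jacobiPoly_mul_of_recurrence (l := 0) hβ (by simp [h0]) (hrec i) k hk.le, h0, mul_zero]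
  set l : Fin n → ℂ := fun i => t i * (starRingEnd ℂ) (x i 0) / x i 0 with hl
  have hl0 : ∀ i, l i * x i 0 = t i * (starRingEnd ℂ) (x i 0) := fun i =>
    div_mul_cancel₀ _ (hfirst i)
  have hlmem : ∀ i, l i ∈ Metric.closedBall (0 : ℂ) (A + 2 * B) := by
    intro i
    rw [mem_closedBall_zero_iff, hl]
    simp only [norm_div, norm_mul, RCLike.norm_conj]
    rw [mul_div_cancel_right₀ _ (norm_ne_zero_iff.2 (hfirst i)), norm_real, Real.norm_eq_abs]
    exact abs_le_of_recurrence hβ hA hB (hx0 i) (hne i) (hrec i)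
  set ν : Measure (Metric.closedBall (0 : ℂ) (A + 2 * B)) :=
    ∑ i, ENNReal.ofReal (‖x i 0‖ ^ 2 / 2) • Measure.dirac ⟨l i, hlmem i⟩ with hν
  have hint : ∀ f : ℂ → ℂ,
      ∫ z : Metric.closedBall (0 : ℂ) (A + 2 * B), f z ∂ν = ∑ i, ((‖x i 0‖ ^ 2 / 2 : ℝ) : ℂ) * f (l i) := by
    intro f
    have hd : ∀ i, Integrable (fun z : Metric.closedBall (0 : ℂ) (A + 2 * B) => f z)
        (Measure.dirac ⟨l i, hlmem i⟩) := fun i =>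
      integrable_dirac (by simp [enorm_lt_top])
    rw [hν, integral_finsetSum_measure fun i _ => (hd i).smul_measure ENNReal.ofReal_ne_top]
    refine Finset.sum_congr rfl fun i _ => ?_
    rw [integral_smul_measure, integral_dirac, ENNReal.toReal_ofReal (by positivity), real_smul]
  have hinner : ∀ a < N, ∀ b < N,
      ∫ z : Metric.closedBall (0 : ℂ) (A + 2 * B),
        jacobiPoly α β a z * (starRingEnd ℂ) (jacobiPoly α β b z) ∂ν =
        if a = b then 1 else 0 := by
    intro a ha b hb
    have h2 : ∀ i, ((‖x i 0‖ ^ 2 / 2 : ℝ) : ℂ) *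
        (jacobiPoly α β a (l i) * (starRingEnd ℂ) (jacobiPoly α β b (l i))) =
        (1 / 2) * (x i a * (starRingEnd ℂ) (x i b)) := fun i => by
      rw [eq_jacobiPoly_mul_of_recurrence hβ (hl0 i) (hrec i) a ha.le,
        eq_jacobiPoly_mul_of_recurrence hβ (hl0 i) (hrec i) b hb.le, map_mul]
      push_cast
      rw [← mul_conj']
      ring
    rw [hint fun z => jacobiPoly α β a z * (starRingEnd ℂ) (jacobiPoly α β b z)]
    simp only [h2]
    rw [← Finset.mul_sum, horth a ha b hb]
    split_ifs <;> norm_num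
  have hprob : IsProbabilityMeasure ν := by
    refine ⟨?_⟩
    have h1 : ∑ i, ‖x i 0‖ ^ 2 / 2 = 1 := by
      have h := horth 0 hN 0 hN
      simp only [mul_conj', if_true] at h
      rw [← Finset.sum_div]
      have h' : ∑ i, ‖x i 0‖ ^ 2 = 2 := by exact_mod_cast h
      rw [h']
      norm_num
    rw [hν, Measure.finsetSum_apply]
    simp only [Measure.smul_apply, measure_univ, smul_eq_mul, mul_one]
    rw [← ENNReal.ofReal_sum_of_nonneg fun i _ => by positivity, h1, ENNReal.ofReal_one]
  exact ⟨⟨ν, hprob⟩, hinner⟩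

open Filter Topology in
/-- A weak limit point of the spectral measures of the truncations, which exists by compactness of
the space of probability measures on a disc. -/
theorem exists_limit_measure {A B : ℝ} (hβ : ∀ j, 0 < β j) (hA : ∀ j, ‖α j‖ ≤ A)
    (hB : ∀ j, β j ≤ B) :
    ∃ ν : ProbabilityMeasure (Metric.closedBall (0 : ℂ) (A + 2 * B)), ∀ a b,
      ∫ z : Metric.closedBall (0 : ℂ) (A + 2 * B),
        jacobiPoly α β a z * (starRingEnd ℂ) (jacobiPoly α β b z) ∂(ν : Measure _) =
        if a = b then 1 else 0 := by
  choose ν hν using fun N : ℕ => exists_truncated_measure (N := N + 1) hβ hA hB N.succ_pos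
  have : CompactSpace (Metric.closedBall (0 : ℂ) (A + 2 * B)) :=
    isCompact_iff_compactSpace.1 (isCompact_closedBall _ _)
  obtain ⟨ν', -, hν'⟩ := isCompact_univ.ultrafilter_le_nhds ((hyperfilter ℕ).map ν) (by simp)
  have hlim : Tendsto ν (hyperfilter ℕ) (𝓝 ν') := hν'
  rw [ProbabilityMeasure.tendsto_iff_forall_integral_rclike_tendsto ℂ] at hlim
  refine ⟨ν', fun a b => ?_⟩
  have hc : Continuous fun z : Metric.closedBall (0 : ℂ) (A + 2 * B) =>
      jacobiPoly α β a z * (starRingEnd ℂ) (jacobiPoly α β b z) :=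
    ((continuous_jacobiPoly α β a).mul
      (continuous_conj.comp (continuous_jacobiPoly α β b))).comp continuous_subtype_val
  have h := hlim (BoundedContinuousFunction.mkOfCompact ⟨_, hc⟩)
  refine tendsto_nhds_unique h (tendsto_const_nhds.congr' ?_)
  have hev : ∀ᶠ N in (hyperfilter ℕ : Filter ℕ), max a b ≤ N :=
    Nat.hyperfilter_le_atTop (eventually_ge_atTop _)
  filter_upwards [hev] with N hN
  exact (hν N a (by omega) b (by omega)).symm

end Disc

/-! ### Symmetric biradial measures -/

section Biradial

theorem Continuous.integrable_of_compl_null {μ : Measure ℂ} [IsFiniteMeasure μ] {K : Set ℂ}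
    (hK : IsCompact K) (hμ : μ Kᶜ = 0) {f : ℂ → ℂ} (hf : Continuous f) : Integrable f μ := by
  rw [← Measure.restrict_eq_self_of_ae_mem (show ∀ᵐ z ∂μ, z ∈ K from hμ)]
  exact hf.continuousOn.integrableOn_compact hK

theorem norm_biradialCurve (φ : ℝ≥0 → ℝ) (r : ℝ≥0) : ‖biradialCurve φ r‖ = r := by
  rw [biradialCurve, norm_mul, mul_comm I, norm_exp_ofReal_mul_I]
  simp

/-- The conditional expectation of `z / |z|` given `|z|`, as a function of `|z|`. It is the mean of
a conditional distribution cut off outside the unit disc; the cut-off changes it only on a null set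
and makes it of norm at most `1` at every radius. -/
noncomputable def meanPhase (ν : Measure ℂ) [IsFiniteMeasure ν] (r : ℝ≥0) : ℂ :=
  ∫ y, y * (if ‖y‖ ≤ 1 then 1 else 0)
    ∂(ProbabilityTheory.condDistrib (fun z : ℂ => z / ‖z‖) (fun z => ‖z‖₊) ν r)

theorem measurable_meanPhase (ν : Measure ℂ) [IsFiniteMeasure ν] : Measurable (meanPhase ν) := by
  have h : StronglyMeasurable fun p : ℝ≥0 × ℂ => p.2 * (if ‖p.2‖ ≤ 1 then (1 : ℂ) else 0) := by
    refine Measurable.stronglyMeasurable (measurable_snd.mul (Measurable.ite ?_ ?_ ?_))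
    · exact measurableSet_le (by fun_prop) (by fun_prop)
    · fun_prop
    · fun_prop
  exact h.integral_condDistrib.measurable

theorem norm_meanPhase_le (ν : Measure ℂ) [IsFiniteMeasure ν] (r : ℝ≥0) :
    ‖meanPhase ν r‖ ≤ 1 := by
  refine (norm_integral_le_of_norm_le_const (C := 1) (ae_of_all _ fun y => ?_)).trans (by simp)
  split_ifs with h <;> simp [h]

theorem integral_radial_mul_id {ν : Measure ℂ} [IsFiniteMeasure ν] {v : ℝ → ℂ}
    (hv : Continuous v) (hint : Integrable (fun z : ℂ => v ‖z‖ * z) ν) :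
    ∫ z, v ‖z‖ * z ∂ν = ∫ r : ℝ≥0, v r * (r * meanPhase ν r) ∂(ν.map fun z => ‖z‖₊) := by
  have hθ : Measurable fun z : ℂ => z / ‖z‖ := by fun_prop
  have hle : ∀ z : ℂ, ‖z / ‖z‖‖ ≤ 1 := fun z => by
    rw [norm_div, norm_real, norm_norm]
    exact div_self_le_one _
  have hpair : Measurable fun z : ℂ => (‖z‖₊, z / (‖z‖ : ℂ)) := by fun_prop
  set f : ℝ≥0 × ℂ → ℂ :=
    fun p => v p.1 * (p.1 * (p.2 * (if ‖p.2‖ ≤ 1 then (1 : ℂ) else 0))) with hf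
  have hfm : Measurable f := by
    refine Measurable.mul (by fun_prop) (Measurable.mul (by fun_prop)
      (measurable_snd.mul (Measurable.ite ?_ measurable_const measurable_const)))
    exact measurableSet_le (by fun_prop) (by fun_prop)
  have hfz : ∀ z : ℂ, f (‖z‖₊, z / (‖z‖ : ℂ)) = v ‖z‖ * z := by
    intro z
    simp only [hf, hle z, if_true, mul_one, coe_nnnorm]
    rcases eq_or_ne z 0 with rfl | hz
    · simp
    · rw [mul_div_cancel₀ _ (ofReal_ne_zero.2 (norm_ne_zero_iff.2 hz))]
  have hmap : Integrable f (ν.map fun z : ℂ => (‖z‖₊, z / (‖z‖ : ℂ))) := by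
    rw [integrable_map_measure hfm.aestronglyMeasurable hpair.aemeasurable]
    exact hint.congr (ae_of_all _ fun z => (hfz z).symm)
  have h1 : ∫ z, v ‖z‖ * z ∂ν = ∫ p, f p ∂(ν.map fun z : ℂ => (‖z‖₊, z / (‖z‖ : ℂ))) := by
    rw [integral_map hpair.aemeasurable hfm.aestronglyMeasurable]
    simp only [hfz]
  have hdis := ProbabilityTheory.compProd_map_condDistrib (mβ := inferInstance) (μ := ν)
    (X := fun z : ℂ => ‖z‖₊) hθ.aemeasurable
  rw [h1, ← hdis, Measure.integral_compProd (hdis ▸ hmap)]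
  simp only [hf, integral_const_mul, meanPhase]

theorem integral_curveMeasure_withDensity {σ : Measure ℝ≥0} {g : ℝ≥0 → ℝ≥0} (hg : Measurable g)
    {φ : ℝ≥0 → ℝ} (hφ : Measurable φ) {f : ℂ → ℂ} (hf : Continuous f) :
    ∫ z, f z ∂(curveMeasure (σ.withDensity fun r => g r) φ) =
      ∫ r, g r • f (biradialCurve φ r) ∂σ := by
  rw [curveMeasure, integral_map (measurable_biradialCurve hφ).aemeasurable
    hf.aestronglyMeasurable, integral_withDensity_eq_integral_smul hg]

theorem integrable_curveMeasure_withDensity {σ : Measure ℝ≥0} {g : ℝ≥0 → ℝ≥0} (hg : Measurable g)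
    {φ : ℝ≥0 → ℝ} (hφ : Measurable φ) {f : ℂ → ℂ} (hf : Continuous f) :
    Integrable f (curveMeasure (σ.withDensity fun r => g r) φ) ↔
      Integrable (fun r => g r • f (biradialCurve φ r)) σ := by
  rw [curveMeasure, integrable_map_measure hf.aestronglyMeasurable
    (measurable_biradialCurve hφ).aemeasurable, integrable_withDensity_iff_integrable_smul hg]
  rfl

theorem curveMeasure_compl_closedBall {σ : Measure ℝ≥0} {R : ℝ} (hσ : σ {r | R < r} = 0)
    {φ : ℝ≥0 → ℝ} (hφ : Measurable φ) :
    curveMeasure σ φ (Metric.closedBall 0 R)ᶜ = 0 := by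
  rw [curveMeasure, Measure.map_apply (measurable_biradialCurve hφ)
    measurableSet_closedBall.compl]
  convert hσ using 2
  ext r
  simp [norm_biradialCurve]

/-- Every probability measure on a disc has the same integrals of functions `u(|z|)` and `v(|z|) z`
as a symmetric biradial one: on the circle of radius `r`, a mean `r w` with `|w| ≤ 1` is attained
by two antipodal points, in the direction of `w` and opposite to it, of masses `(1 ± |w|) / 2`. -/
theorem exists_isSymmetricBiradial_integral_eq (ν : Measure ℂ) [IsProbabilityMeasure ν] {R : ℝ}
    (hν : ν (Metric.closedBall 0 R)ᶜ = 0) :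
    ∃ μ : Measure ℂ, IsSymmetricBiradial μ ∧ IsProbabilityMeasure μ ∧
      μ (Metric.closedBall 0 R)ᶜ = 0 ∧
      (∀ u : ℝ → ℂ, Continuous u → ∫ z, u ‖z‖ ∂μ = ∫ z, u ‖z‖ ∂ν) ∧
      ∀ v : ℝ → ℂ, Continuous v → ∫ z, v ‖z‖ * z ∂μ = ∫ z, v ‖z‖ * z ∂ν := by
  set σ : Measure ℝ≥0 := ν.map fun z => ‖z‖₊ with hσdef
  have hσ : IsProbabilityMeasure σ := Measure.isProbabilityMeasure_map (by fun_prop)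
  have hσR : σ {r : ℝ≥0 | R < r} = 0 := by
    rw [hσdef, Measure.map_apply (by fun_prop) (measurableSet_lt (by fun_prop) (by fun_prop))]
    convert hν using 2
    ext z
    simp
  set w := meanPhase ν with hw
  have hwm : Measurable w := measurable_meanPhase ν
  have hw1 : ∀ r, ‖w r‖ ≤ 1 := norm_meanPhase_le ν
  set g₁ : ℝ≥0 → ℝ≥0 := fun r => ((1 + ‖w r‖) / 2).toNNReal with hg₁
  set g₂ : ℝ≥0 → ℝ≥0 := fun r => ((1 - ‖w r‖) / 2).toNNReal with hg₂
  have hg₁m : Measurable g₁ := by fun_prop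
  have hg₂m : Measurable g₂ := by fun_prop
  have hg₁c : ∀ r, (g₁ r : ℝ) = (1 + ‖w r‖) / 2 := fun r => Real.coe_toNNReal _ (by positivity)
  have hg₂c : ∀ r, (g₂ r : ℝ) = (1 - ‖w r‖) / 2 := fun r =>
    Real.coe_toNNReal _ (by linarith [hw1 r])
  have hg : ∀ r, g₁ r + g₂ r = 1 := fun r => by
    apply NNReal.eq
    rw [NNReal.coe_add, hg₁c, hg₂c, NNReal.coe_one]
    ring
  set φ₁ : ℝ≥0 → ℝ := fun r => arg (w r) with hφ₁
  set φ₂ : ℝ≥0 → ℝ := fun r => arg (w r) - Real.pi with hφ₂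
  have hφ₁m : Measurable φ₁ := by fun_prop
  have hφ₂m : Measurable φ₂ := by fun_prop
  set ρ₁ : Measure ℝ≥0 := σ.withDensity fun r => g₁ r with hρ₁
  set ρ₂ : Measure ℝ≥0 := σ.withDensity fun r => g₂ r with hρ₂
  have hmass : ρ₁ Set.univ + ρ₂ Set.univ = 1 := by
    rw [hρ₁, hρ₂, withDensity_apply _ MeasurableSet.univ, withDensity_apply _ MeasurableSet.univ,
      Measure.restrict_univ, ← lintegral_add_left (by fun_prop)]
    simp only [← ENNReal.coe_add, hg]
    simp
  have hμ₁ : curveMeasure ρ₁ φ₁ (Metric.closedBall 0 R)ᶜ = 0 :=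
    curveMeasure_compl_closedBall (withDensity_absolutelyContinuous _ _ hσR) hφ₁m
  have hμ₂ : curveMeasure ρ₂ φ₂ (Metric.closedBall 0 R)ᶜ = 0 :=
    curveMeasure_compl_closedBall (withDensity_absolutelyContinuous _ _ hσR) hφ₂m
  have hfin₁ : IsFiniteMeasure ρ₁ :=
    ⟨lt_of_le_of_lt (le_self_add.trans hmass.le) ENNReal.one_lt_top⟩
  have hfin₂ : IsFiniteMeasure ρ₂ :=
    ⟨lt_of_le_of_lt (le_add_self.trans hmass.le) ENNReal.one_lt_top⟩
  have hfc₁ : IsFiniteMeasure (curveMeasure ρ₁ φ₁) := by unfold curveMeasure; infer_instance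
  have hfc₂ : IsFiniteMeasure (curveMeasure ρ₂ φ₂) := by unfold curveMeasure; infer_instance
  have hint : ∀ f : ℂ → ℂ, Continuous f → ∫ z, f z ∂(curveMeasure ρ₁ φ₁ + curveMeasure ρ₂ φ₂) =
      ∫ r, (g₁ r • f (biradialCurve φ₁ r) + g₂ r • f (biradialCurve φ₂ r)) ∂σ := by
    intro f hf
    have h1 := hf.integrable_of_compl_null (isCompact_closedBall 0 R) hμ₁
    have h2 := hf.integrable_of_compl_null (isCompact_closedBall 0 R) hμ₂
    rw [integral_add_measure h1 h2, integral_curveMeasure_withDensity hg₁m hφ₁m hf,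
      integral_curveMeasure_withDensity hg₂m hφ₂m hf]
    exact (integral_add ((integrable_curveMeasure_withDensity hg₁m hφ₁m hf).1 h1)
      ((integrable_curveMeasure_withDensity hg₂m hφ₂m hf).1 h2)).symm
  refine ⟨curveMeasure ρ₁ φ₁ + curveMeasure ρ₂ φ₂, ⟨ρ₁, ρ₂, φ₁, φ₂, ⟨hmass, hφ₁m, hφ₂m, rfl⟩,
    fun r => ⟨0, by simp [hφ₁, hφ₂]⟩⟩, ⟨?_⟩, by simp [hμ₁, hμ₂], fun u hu => ?_, fun v hv => ?_⟩
  · rw [Measure.add_apply, curveMeasure, curveMeasure,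
      Measure.map_apply (measurable_biradialCurve hφ₁m) MeasurableSet.univ,
      Measure.map_apply (measurable_biradialCurve hφ₂m) MeasurableSet.univ]
    exact hmass
  · rw [hint _ (by fun_prop)]
    simp only [norm_biradialCurve, ← add_smul, hg, one_smul]
    rw [hσdef, integral_map (by fun_prop) (by fun_prop)]
    rfl
  · have hc : Continuous fun z : ℂ => v ‖z‖ * z := by fun_prop
    rw [hint _ hc,
      integral_radial_mul_id hv (hc.integrable_of_compl_null (isCompact_closedBall 0 R) hν)]
    congr 1
    funext r
    have hexp : exp (I * (φ₂ r : ℂ)) = -exp (I * (φ₁ r : ℂ)) := by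
      rw [hφ₂, hφ₁]
      push_cast
      rw [mul_sub, exp_sub, mul_comm I (Real.pi : ℂ), exp_pi_mul_I]
      ring
    have hpolar : (‖w r‖ : ℂ) * exp (I * (φ₁ r : ℂ)) = w r := by
      rw [mul_comm I, hφ₁]
      exact norm_mul_exp_arg_mul_I (w r)
    simp only [norm_biradialCurve, NNReal.smul_def, hg₁c, hg₂c, real_smul]
    simp only [biradialCurve, hexp]
    push_cast
    linear_combination (v r * r) * hpolar

/-- The orthonormality relations only involve integrals of functions `u(|z|)`, `v(|z|) z` and
conjugates of the latter. -/
theorem integral_jacobiPoly_mul_conj_congr {α : ℕ → ℂ} {β : ℕ → ℝ} {μ ν : Measure ℂ}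
    [IsFiniteMeasure μ] [IsFiniteMeasure ν] {K : Set ℂ} (hK : IsCompact K) (hμ : μ Kᶜ = 0)
    (hν : ν Kᶜ = 0)
    (hu : ∀ u : ℝ → ℂ, Continuous u → ∫ z, u ‖z‖ ∂μ = ∫ z, u ‖z‖ ∂ν)
    (hv : ∀ v : ℝ → ℂ, Continuous v → ∫ z, v ‖z‖ * z ∂μ = ∫ z, v ‖z‖ * z ∂ν) (i j : ℕ) :
    ∫ z, jacobiPoly α β i z * (starRingEnd ℂ) (jacobiPoly α β j z) ∂μ =
      ∫ z, jacobiPoly α β i z * (starRingEnd ℂ) (jacobiPoly α β j z) ∂ν := by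
  obtain ⟨a, b, ha, hb, h⟩ := exists_jacobiPoly_eq α β i
  obtain ⟨a', b', ha', hb', h'⟩ := exists_jacobiPoly_eq α β j
  have hca : Continuous fun r => (starRingEnd ℂ) (a r) := continuous_conj.comp ha
  have hca' : Continuous fun r => (starRingEnd ℂ) (a' r) := continuous_conj.comp ha'
  have hcb' : Continuous fun r => (starRingEnd ℂ) (b' r) := continuous_conj.comp hb'
  set u : ℝ → ℂ := fun r =>
    a r * (starRingEnd ℂ) (a' r) + b r * (starRingEnd ℂ) (b' r) * (r : ℂ) ^ 2 with hudef
  set v : ℝ → ℂ := fun r => b r * (starRingEnd ℂ) (a' r) with hvdef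
  set v' : ℝ → ℂ := fun r => (starRingEnd ℂ) (a r) * b' r with hvdef'
  have hcu : Continuous u := by fun_prop
  have hcv : Continuous v := by fun_prop
  have hcv' : Continuous v' := by fun_prop
  have hexp : ∀ z, jacobiPoly α β i z * (starRingEnd ℂ) (jacobiPoly α β j z) =
      u ‖z‖ + v ‖z‖ * z + (starRingEnd ℂ) (v' ‖z‖ * z) := fun z => by
    simp only [h, h', hudef, hvdef, hvdef', map_add, map_mul, conj_conj]
    rw [← mul_conj']
    ring
  have hsplit : ∀ ρ : Measure ℂ, IsFiniteMeasure ρ → ρ Kᶜ = 0 →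
      ∫ z, jacobiPoly α β i z * (starRingEnd ℂ) (jacobiPoly α β j z) ∂ρ =
        ∫ z, u ‖z‖ ∂ρ + ∫ z, v ‖z‖ * z ∂ρ + (starRingEnd ℂ) (∫ z, v' ‖z‖ * z ∂ρ) := by
    intro ρ _ hρ
    have h1 : Integrable (fun z : ℂ => u ‖z‖) ρ :=
      Continuous.integrable_of_compl_null hK hρ (by fun_prop)
    have h2 : Integrable (fun z : ℂ => v ‖z‖ * z) ρ :=
      Continuous.integrable_of_compl_null hK hρ (by fun_prop)
    have h3 : Integrable (fun z : ℂ => (starRingEnd ℂ) (v' ‖z‖ * z)) ρ :=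
      Continuous.integrable_of_compl_null hK hρ (continuous_conj.comp (by fun_prop))
    simp only [hexp]
    refine (integral_add (h1.add h2) h3).trans ?_
    rw [integral_conj]
    exact congrArg (· + _) (integral_add h1 h2)
  rw [hsplit μ inferInstance hμ, hsplit ν inferInstance hν, hu u hcu, hv v hcv, hv v' hcv']

end Biradial

theorem theorem3p3 (α : ℕ → ℂ) (β : ℕ → ℝ) (hβ : ∀ j, 0 < β j)
    (hα_bdd : ∃ M : ℝ, ∀ j, ‖α j‖ ≤ M) (hβ_bdd : ∃ M : ℝ, ∀ j, β j ≤ M) :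
    ∃ μ : Measure ℂ, IsSymmetricBiradial μ ∧ IsCompact μ.support ∧
      HasJacobiParameters μ α β := by
  obtain ⟨A, hA⟩ := hα_bdd
  obtain ⟨B, hB⟩ := hβ_bdd
  obtain ⟨ν', hν'⟩ := exists_limit_measure hβ hA hB
  set ν : Measure ℂ := (ν' : Measure (Metric.closedBall (0 : ℂ) (A + 2 * B))).map Subtype.val
    with hνdef
  have hνp : IsProbabilityMeasure ν :=
    Measure.isProbabilityMeasure_map measurable_subtype_coe.aemeasurable
  have hνK : ν (Metric.closedBall 0 (A + 2 * B))ᶜ = 0 := by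
    rw [hνdef, Measure.map_apply measurable_subtype_coe measurableSet_closedBall.compl]
    convert measure_empty (μ := (ν' : Measure (Metric.closedBall (0 : ℂ) (A + 2 * B))))
    ext z
    simp
  obtain ⟨μ, hsym, hμp, hμK, hu, hv⟩ := exists_isSymmetricBiradial_integral_eq ν hνK
  have hK := isCompact_closedBall (0 : ℂ) (A + 2 * B)
  have hc : ∀ i j, Continuous fun z =>
      jacobiPoly α β i z * (starRingEnd ℂ) (jacobiPoly α β j z) := fun i j =>
    (continuous_jacobiPoly α β i).mul (continuous_conj.comp (continuous_jacobiPoly α β j))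
  have horth : IsJacobiOrthonormal μ α β :=
    { integrable := fun i j => (hc i j).integrable_of_compl_null hK hμK
      inner_eq := fun i j => by
        rw [r2Inner, integral_jacobiPoly_mul_conj_congr hK hμK hνK hu hv, hνdef,
          integral_map measurable_subtype_coe.aemeasurable (hc i j).aestronglyMeasurable]
        exact hν' i j }
  refine ⟨μ, hsym, ?_, horth.hasJacobiParameters hβ ⟨hμp, fun n => ?_⟩⟩
  · exact hK.of_isClosed_subset Measure.isClosed_support
      (Measure.support_subset_of_isClosed Metric.isClosed_closedBall hμK)
  · have h : Integrable (fun z : ℂ => ((‖z‖ : ℂ)) ^ n) μ :=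
      Continuous.integrable_of_compl_null hK hμK (by fun_prop)
    simpa using h.norm
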